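/- Let $\mathbb{T}$ be the unit circle with normalized Lebesgue measure, $L^2=L^2(\mathbb{T})$, and let $H^2\subset L^2$ be the Hardy space. For an inner function $\theta$ put $K^2_\theta=H^2\ominus\theta H^2$, let $P_\theta\colon L^2\to K^2_\theta$ be the orthogonal projection, and let $C_\theta$ be the conjugation on $K^2_\theta$ given by $(C_\theta f)(z)=\theta(z)\overline{z f(z)}$ for $|z|=1$. Write $L(\mathcal{H})$ for the bounded linear operators on a Hilbert space $\mathcal{H}$; an operator $A\in L(K^2_\theta)$ is called $C_\theta$-symmetric if $C_\theta A C_\theta=A^*$. Let $\mathcal{T}(\theta)$ be the set of bounded truncated Toeplitz operators on $K^2_\theta$, i.e. of those $A\in L(K^2_\theta)$ for which there is a symbol $\varphi\in L^2$ such that the operator $f\mapsto P_\theta(\varphi f)$, with dense domain $\{f\in K^2_\theta:\varphi f\in L^2\}$, agrees with $A$ on that domain. An inner function $\alpha$ divides $\theta$ if $\bar\alpha\theta$ is inner; then $K^2_\alpha\subset K^2_\theta$. **Theorem.** Let $$B(z)=e^{i\gamma}\prod_{j=1}^{N}\frac{z-a_j}{1-\bar a_j z},\qquad \gamma\in\mathbb{R},$$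 be a finite Blaschke product of degree $N$ with distinct zeros $a_1,\dots,a_N$ in the open unit disk, and for $n=1,\dots,N$ let $B_n(z)=\prod_{j=1}^{n}\frac{z-a_j}{1-\bar a_j z}$. Let $A\in L(K^2_B)$. The following conditions are equivalent: 1. $A\in\mathcal{T}(B)$; 2. for every (nonconstant, finite) Blaschke product $B_\sigma$ dividing $B$, the compression $A_\sigma=P_{B_\sigma}A_{|K^2_{B_\sigma}}$ is $C_{B_\sigma}$-symmetric; 3. for every $n=1,\dots,N$, the compression $A_n=P_{B_n}A_{|K^2_{B_n}}$ is $C_{B_n}$-symmetric. -/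

import Mathlib

open MeasureTheory AddCircle
open scoped ComplexConjugate InnerProductSpace

/-! The unit circle is parametrized by the angle, `x ↦ toCircle x = e^{ix}`, and carries its
normalized Lebesgue measure `haarAddCircle`. -/

/-- The unit circle `𝕋`. -/
abbrev UnitTorus : Type := AddCircle (2 * Real.pi)

instance instFactTwoPiPos : Fact (0 < 2 * Real.pi) := ⟨Real.two_pi_pos⟩

/-- The normalized Lebesgue measure `m` on `𝕋`. -/
noncomputable abbrev torusMeasure : Measure UnitTorus := haarAddCircle

/-- The Hilbert space `L²(𝕋, m)`. -/
abbrev L2Torus : Type := Lp ℂ 2 torusMeasure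

/-- An inner function, given by its boundary values: a measurable function on `𝕋`, unimodular
almost everywhere, whose Fourier coefficients of negative index vanish. -/
structure IsInner (θ : UnitTorus → ℂ) : Prop where
  aestronglyMeasurable : AEStronglyMeasurable θ torusMeasure
  norm_eq_one : ∀ᵐ x ∂torusMeasure, ‖θ x‖ = 1
  coeff_neg : ∀ n : ℤ, n < 0 → fourierCoeff θ n = 0

theorem fourierCoeff_eq_inner_fourierLp (f : L2Torus) (n : ℤ) :
    fourierCoeff (f : UnitTorus → ℂ) n = ⟪(fourierLp 2 n : L2Torus), f⟫_ℂ := by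
  rw [← fourierBasis_repr, HilbertBasis.repr_apply_apply, coe_fourierBasis]

/-- The Hardy space `H²`, as a subspace of `L²`. -/
noncomputable def hardySpace : Submodule ℂ L2Torus where
  carrier := {f | ∀ n : ℤ, n < 0 → fourierCoeff (f : UnitTorus → ℂ) n = 0}
  add_mem' {f g} hf hg n hn := by
    have h1 := hf n hn
    have h2 := hg n hn
    rw [fourierCoeff_eq_inner_fourierLp] at h1 h2 ⊢
    rw [inner_add_right, h1, h2, add_zero]
  zero_mem' n _ := by rw [fourierCoeff_eq_inner_fourierLp, inner_zero_right]
  smul_mem' c f hf n hn := by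
    have h1 := hf n hn
    rw [fourierCoeff_eq_inner_fourierLp] at h1 ⊢
    rw [inner_smul_right, h1, mul_zero]

/-- The set `θ H²`. -/
def innerMulHardy (θ : UnitTorus → ℂ) : Set L2Torus :=
  {h | ∃ g ∈ hardySpace, h =ᵐ[torusMeasure] fun x => θ x * g x}

/-- The model space `K²_θ = H² ⊖ θ H²`. -/
noncomputable def modelSpace (θ : UnitTorus → ℂ) : Submodule ℂ L2Torus :=
  hardySpace ⊓ (Submodule.span ℂ (innerMulHardy θ))ᗮ

theorem isClosed_hardySpace : IsClosed (hardySpace : Set L2Torus) := by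
  have : (hardySpace : Set L2Torus) =
      ⋂ n : ℤ, ⋂ _ : n < 0, {f : L2Torus | ⟪(fourierLp 2 n : L2Torus), f⟫_ℂ = 0} := by
    ext f
    simp only [Set.mem_iInter, Set.mem_ofPred_eq, ← fourierCoeff_eq_inner_fourierLp]
    rfl
  rw [this]
  exact isClosed_iInter fun n => isClosed_iInter fun _ =>
    isClosed_eq (continuous_const.inner continuous_id) continuous_const

instance instCompleteSpaceModelSpace (θ : UnitTorus → ℂ) : CompleteSpace (modelSpace θ) := by
  have h : IsClosed (modelSpace θ : Set L2Torus) :=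
    isClosed_hardySpace.inter (Submodule.isClosed_orthogonal _)
  exact h.completeSpace_coe

/-- The domain of the truncated Toeplitz operator with symbol `φ`. -/
def truncatedToeplitzDomain (θ : UnitTorus → ℂ) (φ : L2Torus) : Set (modelSpace θ) :=
  {f | MemLp (fun x => φ x * (f : L2Torus) x) 2 torusMeasure}

/-- `A ∈ 𝒯(θ)`: the bounded operator `A` on `K²_θ` is a truncated Toeplitz operator, that is, for
some symbol `φ ∈ L²` the densely defined operator `f ↦ P_θ (φ f)` agrees with `A` on its domain. -/
def IsTruncatedToeplitz (θ : UnitTorus → ℂ) (A : modelSpace θ →L[ℂ] modelSpace θ) : Prop :=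
  ∃ φ : L2Torus, Dense (truncatedToeplitzDomain θ φ) ∧
    ∀ (f : modelSpace θ) (hf : f ∈ truncatedToeplitzDomain θ φ),
      A f = (modelSpace θ).orthogonalProjectionOnto (MemLp.toLp _ hf)

/-- `A` is `C`-symmetric: `C A C = A*`. -/
def IsCSymmetric {H : Type*} [NormedAddCommGroup H] [InnerProductSpace ℂ H] [CompleteSpace H]
    (C : H →ₗ⋆[ℂ] H) (A : H →L[ℂ] H) : Prop :=
  ∀ f : H, C (A (C f)) = ContinuousLinearMap.adjoint A f

theorem inner_toLp_toLp {f g : UnitTorus → ℂ} (hf : MemLp f 2 torusMeasure)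
    (hg : MemLp g 2 torusMeasure) :
    ⟪(hf.toLp f : L2Torus), hg.toLp g⟫_ℂ = ∫ x, conj (f x) * g x ∂torusMeasure := by
  rw [L2.inner_def]
  refine integral_congr_ae ?_
  filter_upwards [hf.coeFn_toLp, hg.coeFn_toLp] with x h1 h2
  rw [h1, h2, RCLike.inner_apply, mul_comm]

theorem fourierCoeff_eq_integral_mul (f : UnitTorus → ℂ) (n : ℤ) :
    fourierCoeff f n = ∫ x, fourier (-n) x * f x ∂torusMeasure := by
  simp [fourierCoeff]

/-- The product of two functions with nonnegative spectrum has nonnegative spectrum. -/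
theorem fourierCoeff_mul_eq_zero {f g : UnitTorus → ℂ} (hf : MemLp f 2 torusMeasure)
    (hg : MemLp g 2 torusMeasure) (hf0 : ∀ n : ℤ, n < 0 → fourierCoeff f n = 0)
    (hg0 : ∀ n : ℤ, n < 0 → fourierCoeff g n = 0) (n : ℤ) (hn : n < 0) :
    fourierCoeff (fun x => f x * g x) n = 0 := by
  have hu : MemLp (fun x => fourier n x * conj (f x)) 2 torusMeasure := by
    refine hf.of_le ((by fun_prop : Continuous fun x : UnitTorus => fourier n x)
      |>.aestronglyMeasurable.mul (hf.1.star)) (Filter.Eventually.of_forall fun x => ?_)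
    rw [norm_mul, RCLike.norm_conj, fourier_apply, Circle.norm_coe, one_mul]
  have h1 : fourierCoeff (fun x => f x * g x) n = ⟪(hu.toLp _ : L2Torus), hg.toLp g⟫_ℂ := by
    rw [inner_toLp_toLp, fourierCoeff_eq_integral_mul]
    refine integral_congr_ae (Filter.Eventually.of_forall fun x => ?_)
    simp only [map_mul, Complex.conj_conj, fourier_neg, mul_assoc]
  rw [h1, ← (fourierBasis (T := 2 * Real.pi)).tsum_inner_mul_inner]
  refine (tsum_congr fun k => ?_).trans tsum_zero
  rw [coe_fourierBasis]
  rcases lt_or_ge k 0 with hk | hk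
  · have : ⟪(fourierLp 2 k : L2Torus), hg.toLp g⟫_ℂ = 0 := by
      rw [← fourierCoeff_eq_inner_fourierLp, fourierCoeff_congr_ae hg.coeFn_toLp]
      exact hg0 k hk
    rw [this, mul_zero]
  · have : ⟪(hu.toLp _ : L2Torus), (fourierLp 2 k : L2Torus)⟫_ℂ = 0 := by
      rw [L2.inner_def, ← hf0 (n - k) (by omega), fourierCoeff_eq_integral_mul]
      refine integral_congr_ae ?_
      filter_upwards [hu.coeFn_toLp, coeFn_fourierLp (T := 2 * Real.pi) 2 k] with x h2 h3
      rw [h2, h3, RCLike.inner_apply, neg_sub, sub_eq_add_neg, fourier_add, fourier_neg]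
      simp only [map_mul, Complex.conj_conj]
      ring
    rw [this, zero_mul]

theorem IsInner.memLp {θ : UnitTorus → ℂ} (hθ : IsInner θ) : MemLp θ 2 torusMeasure :=
  MemLp.of_bound hθ.aestronglyMeasurable 1 (hθ.norm_eq_one.mono fun _ h => h.le)

theorem IsInner.memLp_mul {θ f : UnitTorus → ℂ} (hθ : IsInner θ) (hf : MemLp f 2 torusMeasure) :
    MemLp (fun x => θ x * f x) 2 torusMeasure := by
  refine hf.of_le (hθ.aestronglyMeasurable.mul hf.1) ?_
  filter_upwards [hθ.norm_eq_one] with x hx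
  simp [hx]

theorem IsInner.mul {θ η : UnitTorus → ℂ} (hθ : IsInner θ) (hη : IsInner η) :
    IsInner (fun x => θ x * η x) where
  aestronglyMeasurable := hθ.aestronglyMeasurable.mul hη.aestronglyMeasurable
  norm_eq_one := by
    filter_upwards [hθ.norm_eq_one, hη.norm_eq_one] with x h1 h2
    simp [h1, h2]
  coeff_neg := fourierCoeff_mul_eq_zero hθ.memLp hη.memLp hθ.coeff_neg hη.coeff_neg

theorem IsInner.memLp_conj {θ : UnitTorus → ℂ} (hθ : IsInner θ) (f : L2Torus) :
    MemLp (fun x => θ x * conj ((toCircle x : ℂ) * f x)) 2 torusMeasure := by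
  refine hθ.memLp_mul ((Lp.memLp f).of_le ?_ (Filter.Eventually.of_forall fun x => ?_))
  · exact ((by fun_prop : Continuous fun x : UnitTorus => (fourier 1 x : ℂ)).aestronglyMeasurable.congr
      (Filter.Eventually.of_forall fun x => by simp [fourier_apply])
      |>.mul (Lp.aestronglyMeasurable f)).star
  · rw [RCLike.norm_conj, norm_mul, Circle.norm_coe, one_mul]

theorem mem_modelSpace_iff {θ : UnitTorus → ℂ} (hθ : IsInner θ) (f : L2Torus) :
    f ∈ modelSpace θ ↔ f ∈ hardySpace ∧
      ∀ g ∈ hardySpace, ∫ x, conj (θ x * g x) * f x ∂torusMeasure = 0 := by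
  have key : ∀ h g : L2Torus, (h =ᵐ[torusMeasure] fun x => θ x * g x) →
      ⟪h, f⟫_ℂ = ∫ x, conj (θ x * g x) * f x ∂torusMeasure := fun h g hh => by
    rw [L2.inner_def]
    refine integral_congr_ae ?_
    filter_upwards [hh] with x hx
    rw [hx, RCLike.inner_apply, mul_comm]
  refine and_congr_right fun _ => ⟨fun H g hg => ?_, fun H => ?_⟩
  · have hm := hθ.memLp_mul (Lp.memLp g)
    rw [← key _ g hm.coeFn_toLp]
    exact H _ (Submodule.subset_span ⟨g, hg, hm.coeFn_toLp⟩)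
  · refine (Submodule.mem_orthogonal _ _).2 fun u hu => ?_
    induction hu using Submodule.span_induction with
    | mem u hu =>
      obtain ⟨g, hg, hu⟩ := hu
      rw [key u g hu, H g hg]
    | zero => exact inner_zero_left _
    | add u v _ _ h1 h2 => rw [inner_add_left, h1, h2, add_zero]
    | smul c u _ h1 => rw [inner_smul_left, h1, mul_zero]

theorem fourierLp_mem_hardySpace (k : ℤ) (hk : 0 ≤ k) : (fourierLp 2 k : L2Torus) ∈ hardySpace := by
  intro n hn
  rw [fourierCoeff_eq_inner_fourierLp]
  exact orthonormal_fourier.2 (by omega)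

theorem IsInner.conj_mem_modelSpace {θ : UnitTorus → ℂ} (hθ : IsInner θ) {f : L2Torus}
    (hf : f ∈ modelSpace θ) : (hθ.memLp_conj f).toLp _ ∈ modelSpace θ := by
  rw [mem_modelSpace_iff hθ] at hf ⊢
  refine ⟨fun n hn => ?_, fun g hg => ?_⟩
  · rw [fourierCoeff_congr_ae (hθ.memLp_conj f).coeFn_toLp, fourierCoeff_eq_integral_mul]
    have h1 := congrArg conj (hf.2 _ (fourierLp_mem_hardySpace (-n - 1) (by omega)))
    rw [← integral_conj, map_zero] at h1
    rw [← h1]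
    refine integral_congr_ae ?_
    filter_upwards [coeFn_fourierLp (T := 2 * Real.pi) 2 (-n - 1)] with x hx
    rw [hx, sub_eq_add_neg, fourier_add, fourier_neg (n := 1), fourier_one]
    simp only [map_mul, Complex.conj_conj]
    ring
  · have h1 := congrArg conj (fourierCoeff_mul_eq_zero (Lp.memLp g) (Lp.memLp f) hg hf.1 (-1)
      (by norm_num))
    rw [fourierCoeff_eq_integral_mul, ← integral_conj, map_zero] at h1
    rw [← h1]
    refine integral_congr_ae ?_
    filter_upwards [(hθ.memLp_conj f).coeFn_toLp, hθ.norm_eq_one] with x hx h2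
    have h3 : conj (θ x) * θ x = 1 := by rw [Complex.conj_mul', h2]; simp
    rw [hx, neg_neg, fourier_one]
    simp only [map_mul]
    linear_combination (conj (g x) * conj (toCircle x : ℂ) * conj (f x)) * h3

/-- The conjugation `C_θ` on the model space `K²_θ`: `(C_θ f)(z) = θ(z) conj (z f(z))` on `𝕋`. -/
noncomputable def modelConj (θ : UnitTorus → ℂ) (hθ : IsInner θ) :
    modelSpace θ →ₗ⋆[ℂ] modelSpace θ where
  toFun f := ⟨(hθ.memLp_conj (f : L2Torus)).toLp _, hθ.conj_mem_modelSpace f.2⟩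
  map_add' f g := by
    refine Subtype.ext (Eq.trans ?_ (MemLp.toLp_add (hθ.memLp_conj f) (hθ.memLp_conj g)))
    refine MemLp.toLp_congr (hθ.memLp_conj _) _ ?_
    filter_upwards [Lp.coeFn_add (f : L2Torus) (g : L2Torus)] with x hx
    simp only [Submodule.coe_add, hx, Pi.add_apply, mul_add, map_add]
  map_smul' c f := by
    refine Subtype.ext (Eq.trans ?_ (MemLp.toLp_const_smul (conj c) (hθ.memLp_conj f)))
    refine MemLp.toLp_congr (hθ.memLp_conj _) _ ?_
    filter_upwards [Lp.coeFn_smul c (f : L2Torus)] with x hx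
    simp only [Submodule.coe_smul, hx, Pi.smul_apply, smul_eq_mul, map_mul]
    ring

/-- `α` divides `θ`: the quotient `conj α * θ` is an inner function. -/
def InnerDivides (α θ : UnitTorus → ℂ) : Prop := IsInner fun x => conj (α x) * θ x

theorem modelSpace_le_of_innerDivides {α θ : UnitTorus → ℂ} (hα : IsInner α)
    (h : InnerDivides α θ) : modelSpace α ≤ modelSpace θ := by
  refine inf_le_inf le_rfl (Submodule.orthogonal_le (Submodule.span_mono ?_))
  rintro u ⟨g, hg, hu⟩
  have hm := h.memLp_mul (Lp.memLp g)
  refine ⟨hm.toLp _, fun n hn => ?_, ?_⟩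
  · rw [fourierCoeff_congr_ae hm.coeFn_toLp]
    exact fourierCoeff_mul_eq_zero h.memLp (Lp.memLp g) h.coeff_neg hg n hn
  · filter_upwards [hu, hm.coeFn_toLp, hα.norm_eq_one] with x h1 h2 h3
    have h4 : conj (α x) * α x = 1 := by rw [Complex.conj_mul', h3]; simp
    rw [h1, h2]
    linear_combination (-(θ x * g x)) * h4

/-- The compression `P_α A|_{K²_α}` of an operator `A` on `K²_θ` to the subspace `K²_α`, where
`α` divides `θ`. -/
noncomputable def compression (α θ : UnitTorus → ℂ) (hα : IsInner α) (h : InnerDivides α θ)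
    (A : modelSpace θ →L[ℂ] modelSpace θ) : modelSpace α →L[ℂ] modelSpace α :=
  (modelSpace α).orthogonalProjectionOnto ∘L (modelSpace θ).subtypeL ∘L A ∘L
    ((modelSpace α).subtypeL.codRestrict (modelSpace θ)
      fun f => modelSpace_le_of_innerDivides hα h f.2)

open Complex.UnitDisc

/-- The finite Blaschke product `c ∏ⱼ (z - aⱼ) / (1 - conj aⱼ z)` with zeros `a₁, …, aₘ` in the
open unit disk and unimodular constant `c`. -/
noncomputable def blaschke {m : ℕ} (c : Circle) (a : Fin m → 𝔻) (z : ℂ) : ℂ :=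
  c * ∏ j, (z - (a j : ℂ)) / (1 - conj (a j : ℂ) * z)

/-- The restriction of a function to the unit circle. -/
noncomputable def onTorus (F : ℂ → ℂ) (x : UnitTorus) : ℂ := F (toCircle x)

/-- The first `n` of the points `a₁, …, a_N`. -/
def initialZeros {N : ℕ} (a : Fin N → 𝔻) {n : ℕ} (hn : n ≤ N) : Fin n → 𝔻 :=
  fun j => a (Fin.castLE hn j)

theorem one_sub_conj_mul_ne_zero (a : 𝔻) (x : UnitTorus) :
    1 - conj (a : ℂ) * (toCircle x : ℂ) ≠ 0 := by
  intro h
  have h1 : ‖conj (a : ℂ) * (toCircle x : ℂ)‖ = 1 := by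
    rw [← sub_eq_zero.1 h, norm_one]
  rw [norm_mul, Circle.norm_coe, mul_one, RCLike.norm_conj] at h1
  exact a.norm_lt_one.ne h1

theorem isInner_const (c : Circle) : IsInner fun _ => (c : ℂ) where
  aestronglyMeasurable := aestronglyMeasurable_const
  norm_eq_one := Filter.Eventually.of_forall fun _ => c.norm_coe
  coeff_neg n hn := by
    have h : fourierCoeff (fun _ : UnitTorus => (c : ℂ)) n
        = c * ⟪(fourierLp 2 n : L2Torus), (fourierLp 2 0 : L2Torus)⟫_ℂ := by
      rw [← fourierCoeff_eq_inner_fourierLp, ← fourierCoeff.const_mul]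
      refine congrFun (fourierCoeff_congr_ae ?_) n
      filter_upwards [coeFn_fourierLp (T := 2 * Real.pi) 2 0] with x hx
      rw [hx, fourier_zero, mul_one]
    rw [h, orthonormal_fourier.2 (by omega : n ≠ 0), mul_zero]

theorem continuous_toCircle_coe : Continuous fun x : UnitTorus => (toCircle x : ℂ) := by
  have : (fun x : UnitTorus => (toCircle x : ℂ)) = fun x => fourier 1 x := by
    ext x; exact fourier_one.symm
  rw [this]
  fun_prop

theorem isInner_blaschkeFactor (a : 𝔻) :
    IsInner fun x => ((toCircle x : ℂ) - (a : ℂ)) / (1 - conj (a : ℂ) * (toCircle x : ℂ)) := by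
  set b : UnitTorus → ℂ :=
    fun x => ((toCircle x : ℂ) - (a : ℂ)) / (1 - conj (a : ℂ) * (toCircle x : ℂ)) with hb
  have hcont : Continuous b :=
    (continuous_toCircle_coe.sub continuous_const).div
      (continuous_const.sub (continuous_const.mul continuous_toCircle_coe))
      (one_sub_conj_mul_ne_zero a)
  have hnorm : ∀ x, ‖b x‖ = 1 := by
    intro x
    have hz : conj (toCircle x : ℂ) * (toCircle x : ℂ) = 1 := by
      rw [Complex.conj_mul', Circle.norm_coe]; simp
    have h1 : (toCircle x : ℂ) - (a : ℂ)
        = (toCircle x : ℂ) * conj (1 - conj (a : ℂ) * (toCircle x : ℂ)) := by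
      simp only [map_sub, map_mul, map_one, Complex.conj_conj]
      linear_combination (a : ℂ) * hz
    have h2 : ‖1 - conj (a : ℂ) * (toCircle x : ℂ)‖ ≠ 0 :=
      norm_ne_zero_iff.2 (one_sub_conj_mul_ne_zero a x)
    rw [hb]
    simp only
    rw [norm_div, h1, norm_mul, RCLike.norm_conj, Circle.norm_coe, one_mul, div_self h2]
  have hint : ∀ g : UnitTorus → ℂ, Continuous g → Integrable g torusMeasure := fun g hg =>
    hg.integrable_of_hasCompactSupport (HasCompactSupport.of_compactSpace g)
  refine ⟨hcont.aestronglyMeasurable, Filter.Eventually.of_forall hnorm, ?_⟩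
  have hbound : ∀ n, ‖fourierCoeff b n‖ ≤ 1 := fun n => by
    rw [fourierCoeff_eq_integral_mul]
    refine (norm_integral_le_of_norm_le_const (C := 1)
      (Filter.Eventually.of_forall fun x => ?_)).trans (by simp)
    rw [norm_mul, hnorm, fourier_apply, Circle.norm_coe, one_mul]
  have hmon : ∀ n k : ℤ, n ≠ k → fourierCoeff (fun x : UnitTorus => fourier k x) n = 0 := by
    intro n k h
    rw [← (orthonormal_fourier (T := 2 * Real.pi)).2 h, ← fourierCoeff_eq_inner_fourierLp]
    exact (congrFun (fourierCoeff_congr_ae (coeFn_fourierLp (T := 2 * Real.pi) 2 k)) n).symm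
  have hrec : ∀ n : ℤ, n < 0 → fourierCoeff b n = conj (a : ℂ) * fourierCoeff b (n - 1) := by
    intro n hn
    have e1 := hmon n 1 (by omega)
    have e0 := hmon n 0 (by omega)
    simp only [fourierCoeff_eq_integral_mul] at e1 e0 ⊢
    rw [← sub_eq_zero, ← integral_const_mul, ← integral_sub]
    · have : ∀ x : UnitTorus, fourier (-n) x * b x - conj (a : ℂ) * (fourier (-(n - 1)) x * b x)
          = fourier (-n) x * fourier 1 x - (a : ℂ) * (fourier (-n) x * fourier 0 x) := by
        intro x
        rw [show -(n - 1) = -n + 1 by ring, fourier_add, fourier_one, fourier_zero]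
        have h1 : b x * (1 - conj (a : ℂ) * (toCircle x : ℂ)) = (toCircle x : ℂ) - (a : ℂ) :=
          div_mul_cancel₀ _ (one_sub_conj_mul_ne_zero a x)
        linear_combination (fourier (-n) x : ℂ) * h1
      simp only [this]
      rw [integral_sub, integral_const_mul, e1, e0]
      · simp
      · exact hint _ (by fun_prop)
      · exact hint _ (by fun_prop)
    · exact hint _ (by fun_prop)
    · exact hint _ (by fun_prop)
  have hiter : ∀ (k : ℕ) (n : ℤ), n < 0 → ‖fourierCoeff b n‖ ≤ ‖(a : ℂ)‖ ^ k := by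
    intro k
    induction k with
    | zero => intro n _; simpa using hbound n
    | succ k ih =>
      intro n hn
      rw [hrec n hn, norm_mul, RCLike.norm_conj, pow_succ']
      exact mul_le_mul_of_nonneg_left (ih _ (by omega)) (norm_nonneg _)
  intro n hn
  have h0 := tendsto_pow_atTop_nhds_zero_of_lt_one (norm_nonneg (a : ℂ)) a.norm_lt_one
  exact norm_le_zero_iff.1 (ge_of_tendsto' h0 fun k => hiter k n hn)

theorem isInner_prod_blaschkeFactor {m : ℕ} (a : Fin m → 𝔻) :
    IsInner fun x => ∏ j,
      ((toCircle x : ℂ) - (a j : ℂ)) / (1 - conj (a j : ℂ) * (toCircle x : ℂ)) := by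
  induction m with
  | zero => simpa using isInner_const 1
  | succ m ih =>
    simp only [Fin.prod_univ_succ]
    exact (isInner_blaschkeFactor (a 0)).mul (ih fun j => a j.succ)

theorem isInner_blaschke {m : ℕ} (c : Circle) (a : Fin m → 𝔻) : IsInner (onTorus (blaschke c a)) :=
  (isInner_const c).mul (isInner_prod_blaschkeFactor a)

theorem innerDivides_blaschke_initialZeros {N : ℕ} (c : Circle) (a : Fin N → 𝔻) {n : ℕ}
    (hn : n ≤ N) :
    InnerDivides (onTorus (blaschke 1 (initialZeros a hn))) (onTorus (blaschke c a)) := by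
  obtain ⟨k, rfl⟩ := Nat.exists_eq_add_of_le hn
  have h := isInner_blaschke c fun j : Fin k => a (Fin.natAdd n j)
  have h1 := (isInner_blaschke 1 (initialZeros a hn)).norm_eq_one
  have heq : onTorus (blaschke c fun j : Fin k => a (Fin.natAdd n j)) =ᵐ[torusMeasure]
      fun x => conj (onTorus (blaschke 1 (initialZeros a hn)) x) * onTorus (blaschke c a) x := by
    filter_upwards [h1] with x hx
    have h3 : conj (onTorus (blaschke 1 (initialZeros a hn)) x) *
        onTorus (blaschke 1 (initialZeros a hn)) x = 1 := by
      rw [Complex.conj_mul', hx]; simp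
    have h4 : onTorus (blaschke c a) x = onTorus (blaschke 1 (initialZeros a hn)) x *
        onTorus (blaschke c fun j : Fin k => a (Fin.natAdd n j)) x := by
      simp only [onTorus, blaschke, Fin.prod_univ_add, initialZeros, Circle.coe_one]
      have : ∀ j : Fin n, Fin.castLE hn j = Fin.castAdd k j := fun _ => rfl
      simp only [this]
      ring
    rw [h4, ← mul_assoc, h3, one_mul]
  exact ⟨h.aestronglyMeasurable.congr heq,
    by filter_upwards [heq, h.norm_eq_one] with x e1 e2; rw [← e1, e2],
    fun n hn => by rw [← fourierCoeff_congr_ae heq]; exact h.coeff_neg n hn⟩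

/-! Since the zeros are distinct, the Szegő kernels k_j = 1/(1 - conj a_j z) form a basis of the
N-dimensional space K²_B, and ⟪k_i, f⟫ is the value f(a_i). Put κ_ij = ⟪k_i, k_j⟫, which never
vanishes, and m_ij = ⟪k_i, A k_j⟫ / κ_ij. The proof passes through the condition m_ij = u_i + v_j.

A symbol produces symmetry because ⟪C f, A g⟫ is the integral of conj α · z · φ · f · g, which is
symmetric in f and g; this works for every α dividing B
(`IsTruncatedToeplitz.isCSymmetric_compression`).

Conversely, C k_j vanishes at every a_i with i ≠ j, so the C k_j are biorthogonal to the kernels up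
to the scalars β_j. Expanding C k_j in kernels turns C-symmetry of the n-th compression into a
weighted symmetry relation on the leading n × n block of m (`exists_inner_modelConj_szegoModel`).
Induction on n then forces m_ij = u_i + v_j (`exists_eq_add_of_weighted_symm`). Interpolating p(a_i)
= u_i and q(a_j) = conj v_j gives the symbol p + conj q, whose operator has the same matrix as A
(`isTruncatedToeplitz_of_inner_eq`).

Point evaluation is handled on the circle alone: `EvalsTo` records a value at a through division by
z - a inside the disk algebra, so no analytic extension is needed. -/

/-! ### Disk algebra functions on the circle -/

/-- The boundary function of an element of the disk algebra: a continuous function on `𝕋` whose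
Fourier coefficients of negative index vanish. -/
structure IsDiskAlgebra (u : UnitTorus → ℂ) : Prop where
  continuous : Continuous u
  coeff_neg : ∀ n : ℤ, n < 0 → fourierCoeff u n = 0

theorem Continuous.integrable_torus {g : UnitTorus → ℂ} (hg : Continuous g) :
    Integrable g torusMeasure :=
  hg.integrable_of_hasCompactSupport (HasCompactSupport.of_compactSpace g)

theorem Continuous.memLp_torus {g : UnitTorus → ℂ} (hg : Continuous g) :
    MemLp g 2 torusMeasure := by
  obtain ⟨C, hC⟩ := isCompact_univ.exists_bound_of_continuousOn hg.continuousOn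
  exact MemLp.of_bound hg.aestronglyMeasurable C
    (Filter.Eventually.of_forall fun x => hC x (Set.mem_univ x))

theorem Continuous.mul_memLp_torus {g f : UnitTorus → ℂ} (hg : Continuous g)
    (hf : MemLp f 2 torusMeasure) : MemLp (fun x => g x * f x) 2 torusMeasure := by
  obtain ⟨C, hC⟩ := isCompact_univ.exists_bound_of_continuousOn hg.continuousOn
  refine hf.of_le_mul (c := C) (hg.aestronglyMeasurable.mul hf.1)
    (Filter.Eventually.of_forall fun x => ?_)
  rw [norm_mul]
  exact mul_le_mul_of_nonneg_right (hC x (Set.mem_univ x)) (norm_nonneg _)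

theorem Continuous.mul_integrable_torus {g f : UnitTorus → ℂ} (hg : Continuous g)
    (hf : MemLp f 2 torusMeasure) : Integrable (fun x => g x * f x) torusMeasure :=
  (hg.mul_memLp_torus hf).integrable (by norm_num)

namespace IsDiskAlgebra

theorem const (v : ℂ) : IsDiskAlgebra fun _ => v where
  continuous := continuous_const
  coeff_neg n hn := by
    have h := (isInner_const 1).coeff_neg n hn
    have h1 := fourierCoeff.const_mul (T := 2 * Real.pi) (fun _ => ((1 : Circle) : ℂ)) v n
    rw [h, mul_zero] at h1
    simpa using h1

theorem add {u w : UnitTorus → ℂ} (hu : IsDiskAlgebra u) (hw : IsDiskAlgebra w) :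
    IsDiskAlgebra fun x => u x + w x where
  continuous := hu.continuous.add hw.continuous
  coeff_neg n hn := by
    have h1 := hu.coeff_neg n hn
    have h2 := hw.coeff_neg n hn
    rw [fourierCoeff_eq_integral_mul] at h1 h2 ⊢
    simp only [mul_add]
    rw [integral_add, h1, h2, add_zero]
    · exact ((map_continuous (fourier (-n))).mul hu.continuous).integrable_torus
    · exact ((map_continuous (fourier (-n))).mul hw.continuous).integrable_torus

theorem mul {u w : UnitTorus → ℂ} (hu : IsDiskAlgebra u) (hw : IsDiskAlgebra w) :
    IsDiskAlgebra fun x => u x * w x where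
  continuous := hu.continuous.mul hw.continuous
  coeff_neg := fourierCoeff_mul_eq_zero hu.continuous.memLp_torus hw.continuous.memLp_torus
    hu.coeff_neg hw.coeff_neg

theorem of_toCircle : IsDiskAlgebra fun x => (toCircle x : ℂ) where
  continuous := continuous_toCircle_coe
  coeff_neg n hn := by
    rw [← (orthonormal_fourier (T := 2 * Real.pi)).2 (by omega : n ≠ 1),
      ← fourierCoeff_eq_inner_fourierLp]
    refine (congrFun (fourierCoeff_congr_ae ?_) n).symm
    filter_upwards [coeFn_fourierLp (T := 2 * Real.pi) 2 1] with x hx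
    rw [hx, fourier_one]

end IsDiskAlgebra

/-! ### Szegő kernels and Blaschke factors -/

/-- The Szegő kernel `z ↦ 1 / (1 - conj a z)` at the point `a` of the disk. -/
noncomputable def szegoKernel (a : 𝔻) (x : UnitTorus) : ℂ :=
  (1 - conj (a : ℂ) * (toCircle x : ℂ))⁻¹

/-- The Blaschke factor `z ↦ (z - a) / (1 - conj a z)`. -/
noncomputable def blaschkeFactor (a : 𝔻) (x : UnitTorus) : ℂ :=
  ((toCircle x : ℂ) - (a : ℂ)) / (1 - conj (a : ℂ) * (toCircle x : ℂ))

theorem conj_toCircle_mul_self (x : UnitTorus) :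
    conj (toCircle x : ℂ) * (toCircle x : ℂ) = 1 := by
  rw [Complex.conj_mul', Circle.norm_coe]; simp

theorem szegoKernel_mul (a : 𝔻) (x : UnitTorus) :
    szegoKernel a x * (1 - conj (a : ℂ) * (toCircle x : ℂ)) = 1 :=
  inv_mul_cancel₀ (one_sub_conj_mul_ne_zero a x)

theorem blaschkeFactor_eq (a : 𝔻) (x : UnitTorus) :
    blaschkeFactor a x = ((toCircle x : ℂ) - (a : ℂ)) * szegoKernel a x := div_eq_mul_inv _ _

theorem one_sub_conj_mul_coe_ne_zero (a b : 𝔻) : 1 - conj (a : ℂ) * (b : ℂ) ≠ 0 := by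
  intro h
  have h1 : ‖conj (a : ℂ) * (b : ℂ)‖ = 1 := by
    rw [← sub_eq_zero.1 h, norm_one]
  rw [norm_mul, RCLike.norm_conj] at h1
  have := mul_lt_one_of_nonneg_of_lt_one_left (norm_nonneg _) a.norm_lt_one b.norm_lt_one.le
  exact this.ne h1

theorem isDiskAlgebra_blaschkeFactor (a : 𝔻) : IsDiskAlgebra (blaschkeFactor a) where
  continuous := (continuous_toCircle_coe.sub continuous_const).div
      (continuous_const.sub (continuous_const.mul continuous_toCircle_coe))
      (one_sub_conj_mul_ne_zero a)
  coeff_neg := (isInner_blaschkeFactor a).coeff_neg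

/-- With b the Blaschke factor at a, 1 + conj a · b = (1 - |a|²) k_a, so the kernel inherits the
property from b. -/
theorem isDiskAlgebra_szegoKernel (a : 𝔻) : IsDiskAlgebra (szegoKernel a) := by
  have h := ((IsDiskAlgebra.const 1).add ((IsDiskAlgebra.const (conj (a : ℂ))).mul
    (isDiskAlgebra_blaschkeFactor a))).mul (IsDiskAlgebra.const (1 - conj (a : ℂ) * (a : ℂ))⁻¹)
  convert h using 1
  ext x
  rw [eq_mul_inv_iff_mul_eq₀ (one_sub_conj_mul_coe_ne_zero a a), blaschkeFactor_eq]
  linear_combination szegoKernel_mul a x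

/-! ### Point evaluation and division by Blaschke factors -/

/-- `u` is (the boundary function of) `v + (z - a) q` with `q` in the disk algebra; that is, `u`
lies in the disk algebra and takes the value `v` at `a`. -/
def EvalsTo (a : 𝔻) (u : UnitTorus → ℂ) (v : ℂ) : Prop :=
  ∃ q : UnitTorus → ℂ, IsDiskAlgebra q ∧ ∀ x, u x = v + ((toCircle x : ℂ) - (a : ℂ)) * q x

namespace EvalsTo

variable {a : 𝔻} {u w : UnitTorus → ℂ} {v t : ℂ}

theorem isDiskAlgebra (h : EvalsTo a u v) : IsDiskAlgebra u := by
  obtain ⟨q, hq, hu⟩ := h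
  have := (IsDiskAlgebra.const v).add
    ((IsDiskAlgebra.of_toCircle.add (IsDiskAlgebra.const (-(a : ℂ)))).mul hq)
  convert this using 1
  ext x
  rw [hu, sub_eq_add_neg]

theorem const (a : 𝔻) (v : ℂ) : EvalsTo a (fun _ => v) v :=
  ⟨fun _ => 0, IsDiskAlgebra.const 0, fun x => by ring⟩

theorem of_toCircle (a : 𝔻) : EvalsTo a (fun x => (toCircle x : ℂ)) a :=
  ⟨fun _ => 1, IsDiskAlgebra.const 1, fun x => by ring⟩

theorem add (hu : EvalsTo a u v) (hw : EvalsTo a w t) : EvalsTo a (fun x => u x + w x) (v + t) := by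
  obtain ⟨q, hq, h1⟩ := hu
  obtain ⟨r, hr, h2⟩ := hw
  exact ⟨_, hq.add hr, fun x => by simp only [h1, h2]; ring⟩

theorem mul (hu : EvalsTo a u v) (hw : EvalsTo a w t) : EvalsTo a (fun x => u x * w x) (v * t) := by
  have hu' := hu.isDiskAlgebra
  obtain ⟨q, hq, h1⟩ := hu
  obtain ⟨r, hr, h2⟩ := hw
  exact ⟨_, (hu'.mul hr).add (hq.mul (IsDiskAlgebra.const t)), fun x => by simp only [h2, h1]; ring⟩

theorem prod {ι : Type*} (s : Finset ι) {u : ι → UnitTorus → ℂ} {v : ι → ℂ}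
    (h : ∀ i ∈ s, EvalsTo a (u i) (v i)) : EvalsTo a (fun x => ∏ i ∈ s, u i x) (∏ i ∈ s, v i) := by
  classical
  induction s using Finset.induction_on with
  | empty => simpa using const a 1
  | insert i s hi ih =>
    simp only [Finset.prod_insert hi]
    exact (h i (by simp)).mul (ih fun j hj => h j (by simp [hj]))

theorem of_szegoKernel (a b : 𝔻) : EvalsTo a (szegoKernel b) (1 - conj (b : ℂ) * (a : ℂ))⁻¹ := by
  refine ⟨_, (IsDiskAlgebra.const (conj (b : ℂ) * (1 - conj (b : ℂ) * (a : ℂ))⁻¹)).mul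
    (isDiskAlgebra_szegoKernel b), fun x => ?_⟩
  have h1 := one_sub_conj_mul_coe_ne_zero b a
  have h2 := one_sub_conj_mul_ne_zero b x
  simp only [szegoKernel]
  field_simp
  ring

theorem of_blaschkeFactor (a b : 𝔻) :
    EvalsTo a (blaschkeFactor b) (((a : ℂ) - (b : ℂ)) * (1 - conj (b : ℂ) * (a : ℂ))⁻¹) := by
  convert ((of_toCircle a).add (const a (-(b : ℂ)))).mul (of_szegoKernel a b) using 1
  · ext x
    rw [blaschkeFactor_eq, sub_eq_add_neg]
  · rw [sub_eq_add_neg]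

theorem polynomial (a : 𝔻) (p : Polynomial ℂ) :
    EvalsTo a (fun x => p.eval (toCircle x : ℂ)) (p.eval (a : ℂ)) := by
  induction p using Polynomial.induction_on' with
  | add p q hp hq => simpa using hp.add hq
  | monomial n c =>
    simp only [Polynomial.eval_monomial]
    refine (const a c).mul ?_
    have := prod (Finset.range n) fun i _ => of_toCircle a
    simpa using this

end EvalsTo

/-- The integral is the Fourier coefficient of u f at index -1. -/
theorem integral_mul_eq_zero_of_hardy {u f : UnitTorus → ℂ} (hu : IsDiskAlgebra u)
    (hf : MemLp f 2 torusMeasure) (hf0 : ∀ n : ℤ, n < 0 → fourierCoeff f n = 0) :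
    ∫ x, (toCircle x : ℂ) * (u x * f x) ∂torusMeasure = 0 := by
  have := fourierCoeff_mul_eq_zero hu.continuous.memLp_torus hf hu.coeff_neg hf0 (-1) (by norm_num)
  rw [fourierCoeff_eq_integral_mul] at this
  simpa [fourier_one] using this

/-- The reproducing property of the Szegő kernel. -/
theorem EvalsTo.integral_mul {a : 𝔻} {u f : UnitTorus → ℂ} {v : ℂ} (h : EvalsTo a u v)
    (hf : MemLp f 2 torusMeasure) (hf0 : ∀ n : ℤ, n < 0 → fourierCoeff f n = 0) :
    ∫ x, conj (szegoKernel a x) * (u x * f x) ∂torusMeasure =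
      v * ∫ x, conj (szegoKernel a x) * f x ∂torusMeasure := by
  obtain ⟨q, hq, hu⟩ := h
  have hk := (isDiskAlgebra_szegoKernel a).continuous
  -- On the circle conj k_a · (z - a) = z, so the difference of the two sides is the integral of z q
  -- f, which is zero.
  rw [← integral_const_mul, ← sub_eq_zero, ← integral_sub,
    ← integral_mul_eq_zero_of_hardy hq hf hf0]
  · refine integral_congr_ae (Filter.Eventually.of_forall fun x => ?_)
    simp only [hu]
    have h1 := congrArg conj (szegoKernel_mul a x)
    simp only [map_sub, map_mul, map_one, Complex.conj_conj] at h1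
    linear_combination (q x * f x) * ((toCircle x : ℂ) * h1
      + conj (szegoKernel a x) * (a : ℂ) * conj_toCircle_mul_self x)
  · have hu' : Continuous u := (EvalsTo.isDiskAlgebra ⟨q, hq, hu⟩).continuous
    refine (hk.star.mul hu').mul_integrable_torus hf |>.congr
      (Filter.Eventually.of_forall fun x => ?_)
    simp [mul_assoc]
  · exact (Continuous.mul_integrable_torus hk.star hf).const_mul v

theorem integral_conj_szegoKernel (a : 𝔻) :
    ∫ x, conj (szegoKernel a x) ∂torusMeasure = 1 := by
  have h1 := integral_mul_eq_zero_of_hardy (isDiskAlgebra_szegoKernel a)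
    (IsDiskAlgebra.const 1).continuous.memLp_torus (IsDiskAlgebra.const 1).coeff_neg
  rw [integral_conj]
  have h2 : ∫ x, szegoKernel a x ∂torusMeasure =
      ∫ x, (1 + conj (a : ℂ) * ((toCircle x : ℂ) * (szegoKernel a x * 1))) ∂torusMeasure :=
    integral_congr_ae (Filter.Eventually.of_forall fun x => by
      linear_combination szegoKernel_mul a x)
  have hk := (isDiskAlgebra_szegoKernel a).continuous
  have hz := continuous_toCircle_coe
  rw [h2, integral_add, integral_const_mul, h1]
  · simp
  · exact Continuous.integrable_torus continuous_const
  · exact Continuous.integrable_torus (by fun_prop)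

theorem EvalsTo.integral_eq {a : 𝔻} {u : UnitTorus → ℂ} {v : ℂ} (h : EvalsTo a u v) :
    ∫ x, conj (szegoKernel a x) * u x ∂torusMeasure = v := by
  have := h.integral_mul (IsDiskAlgebra.const 1).continuous.memLp_torus
    (IsDiskAlgebra.const 1).coeff_neg
  simpa [integral_conj_szegoKernel] using this

/-- A function in `H²` vanishing at `a` is divisible by the Blaschke factor at `a`. -/
theorem fourierCoeff_conj_blaschkeFactor_mul {a : 𝔻} {f : UnitTorus → ℂ}
    (hf : MemLp f 2 torusMeasure) (hf0 : ∀ n : ℤ, n < 0 → fourierCoeff f n = 0)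
    (h : ∫ x, conj (szegoKernel a x) * f x ∂torusMeasure = 0) (n : ℤ) (hn : n < 0) :
    fourierCoeff (fun x => conj (blaschkeFactor a x) * f x) n = 0 := by
  have hk := (isDiskAlgebra_szegoKernel a).continuous.star
  have hint : ∀ m : ℤ, Integrable (fun x => fourier m x * (conj (szegoKernel a x) * f x))
      torusMeasure := fun m =>
    (((map_continuous (fourier m)).mul hk).mul_integrable_torus hf).congr
      (Filter.Eventually.of_forall fun x => by simp [mul_assoc])
  -- All coefficients of conj k_a · f of index ≤ 0 vanish: from conj k_a · (z - a) = z, consecutive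
  -- ones satisfy a recursion whose inhomogeneous term is a negative coefficient of f, and the
  -- hypothesis at a starts it.
  have key : ∀ m : ℕ, ∫ x, fourier m x * (conj (szegoKernel a x) * f x) ∂torusMeasure = 0 := by
    intro m
    induction m with
    | zero => simpa using h
    | succ m ih =>
      have h1 := hf0 (-(m + 1 : ℕ)) (by omega)
      rw [fourierCoeff_eq_integral_mul, neg_neg] at h1
      rw [← h1, ← sub_eq_zero, ← integral_sub]
      · rw [← mul_zero (a : ℂ), ← ih, ← integral_const_mul]
        refine integral_congr_ae (Filter.Eventually.of_forall fun x => ?_)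
        have h2 := congrArg conj (szegoKernel_mul a x)
        simp only [map_sub, map_mul, map_one, Complex.conj_conj] at h2
        push_cast
        simp only [fourier_add, fourier_one]
        linear_combination (fourier (m : ℤ) x * f x) * ((toCircle x : ℂ) * h2
          + conj (szegoKernel a x) * (a : ℂ) * conj_toCircle_mul_self x)
      · exact hint _
      · exact (map_continuous (fourier _)).mul_integrable_torus hf
  obtain ⟨m, rfl⟩ : ∃ m : ℕ, n = -(m + 1 : ℕ) := ⟨(-n - 1).toNat, by omega⟩
  have h1 := hf0 (-(m + 1 : ℕ)) (by omega)
  rw [fourierCoeff_eq_integral_mul] at h1 ⊢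
  -- This is conj b = (conj z - conj a) conj k_a multiplied by z^(m+1); both resulting terms are
  -- covered by `key`.
  have e : ∀ x, fourier (-(-(m + 1 : ℕ) : ℤ)) x * (conj (blaschkeFactor a x) * f x)
      = fourier (m : ℤ) x * (conj (szegoKernel a x) * f x)
        - conj (a : ℂ) * (fourier ((m + 1 : ℕ) : ℤ) x * (conj (szegoKernel a x) * f x)) := by
    intro x
    rw [blaschkeFactor_eq, neg_neg]
    push_cast
    simp only [fourier_add, fourier_one, map_mul, map_sub]
    linear_combination (fourier (m : ℤ) x * f x * conj (szegoKernel a x)) *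
      conj_toCircle_mul_self x
  simp only [e]
  rw [integral_sub (hint _) ((hint _).const_mul _), integral_const_mul, key, key]
  simp

/-! ### The kernel basis of the model space -/

/-- The Szegő kernel as an element of `L²`. -/
noncomputable def szegoLp (a : 𝔻) : L2Torus :=
  (isDiskAlgebra_szegoKernel a).continuous.memLp_torus.toLp _

theorem coeFn_szegoLp (a : 𝔻) : szegoLp a =ᵐ[torusMeasure] szegoKernel a := MemLp.coeFn_toLp _

theorem inner_szegoLp (a : 𝔻) (f : L2Torus) :
    ⟪szegoLp a, f⟫_ℂ = ∫ x, conj (szegoKernel a x) * f x ∂torusMeasure := by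
  rw [L2.inner_def]
  refine integral_congr_ae ?_
  filter_upwards [coeFn_szegoLp a] with x hx
  rw [hx, RCLike.inner_apply, mul_comm]

theorem EvalsTo.inner_szegoLp {a : 𝔻} {u : UnitTorus → ℂ} {v : ℂ} (h : EvalsTo a u v)
    {f : L2Torus} (hf : f =ᵐ[torusMeasure] u) : ⟪szegoLp a, f⟫_ℂ = v := by
  rw [_root_.inner_szegoLp, ← h.integral_eq]
  refine integral_congr_ae ?_
  filter_upwards [hf] with x hx
  rw [hx]

theorem inner_szegoLp_szegoLp (a b : 𝔻) :
    ⟪szegoLp a, szegoLp b⟫_ℂ = (1 - conj (b : ℂ) * (a : ℂ))⁻¹ :=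
  (EvalsTo.of_szegoKernel a b).inner_szegoLp (coeFn_szegoLp b)

theorem onTorus_blaschke {m : ℕ} (c : Circle) (a : Fin m → 𝔻) (x : UnitTorus) :
    onTorus (blaschke c a) x = c * ∏ j, blaschkeFactor (a j) x := rfl

theorem evalsTo_blaschke {m : ℕ} (c : Circle) (a : Fin m → 𝔻) (w : 𝔻) :
    EvalsTo w (onTorus (blaschke c a)) (blaschke c a w) := by
  have h := (EvalsTo.const w (c : ℂ)).mul
    (EvalsTo.prod Finset.univ fun j _ => EvalsTo.of_blaschkeFactor w (a j))
  simp only [← div_eq_mul_inv] at h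
  exact h

theorem blaschke_zero {m : ℕ} (c : Circle) (a : Fin m → 𝔻) (j : Fin m) :
    blaschke c a (a j) = 0 := by
  rw [blaschke, Finset.prod_eq_zero (Finset.mem_univ j) (by simp), mul_zero]

/-- Orthogonality to B H² holds because ⟪k_j, B g⟫ = B(a_j) g(a_j) and B(a_j) = 0. -/
theorem szegoLp_mem_modelSpace {m : ℕ} (c : Circle) (a : Fin m → 𝔻) (j : Fin m) :
    szegoLp (a j) ∈ modelSpace (onTorus (blaschke c a)) := by
  rw [mem_modelSpace_iff (isInner_blaschke c a)]
  refine ⟨fun n hn => ?_, fun g hg => ?_⟩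
  · rw [fourierCoeff_congr_ae (coeFn_szegoLp (a j))]
    exact (isDiskAlgebra_szegoKernel _).coeff_neg n hn
  · have h := congrArg conj ((evalsTo_blaschke c a (a j)).integral_mul (Lp.memLp g) hg)
    rw [blaschke_zero, zero_mul, map_zero, ← integral_conj] at h
    rw [← h]
    refine integral_congr_ae ?_
    filter_upwards [coeFn_szegoLp (a j)] with x hx
    rw [hx, map_mul conj (conj _), Complex.conj_conj, mul_comm]

/-- The Szegő kernel at a zero of a finite Blaschke product, as an element of the model space. -/
noncomputable def szegoModel {m : ℕ} (c : Circle) (a : Fin m → 𝔻) (j : Fin m) :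
    modelSpace (onTorus (blaschke c a)) := ⟨szegoLp (a j), szegoLp_mem_modelSpace c a j⟩

theorem conj_blaschkeFactor_mul_self (a : 𝔻) (x : UnitTorus) :
    conj (blaschkeFactor a x) * blaschkeFactor a x = 1 := by
  have h1 := szegoKernel_mul a x
  have h2 := congrArg conj h1
  simp only [map_sub, map_mul, map_one, Complex.conj_conj] at h2
  rw [blaschkeFactor_eq]
  simp only [map_mul, map_sub]
  have h3 := conj_toCircle_mul_self x
  have h4 : (conj (toCircle x : ℂ) - conj (a : ℂ)) * (toCircle x : ℂ)
      = 1 - conj (a : ℂ) * (toCircle x : ℂ) := by linear_combination h3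
  have h5 : ((toCircle x : ℂ) - (a : ℂ)) * conj (toCircle x : ℂ)
      = 1 - (a : ℂ) * conj (toCircle x : ℂ) := by linear_combination h3
  calc _ = ((conj (toCircle x : ℂ) - conj (a : ℂ)) * (toCircle x : ℂ)) *
        (((toCircle x : ℂ) - (a : ℂ)) * conj (toCircle x : ℂ)) *
        (szegoKernel a x * conj (szegoKernel a x)) := by
        linear_combination (-(conj (toCircle x : ℂ) - conj (a : ℂ)) * ((toCircle x : ℂ) - (a : ℂ))
          * (szegoKernel a x * conj (szegoKernel a x))) * h3
    _ = 1 := by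
        rw [h4, h5]
        linear_combination (conj (szegoKernel a x) * (1 - (a : ℂ) * conj (toCircle x : ℂ))) * h1
          + h2

/-- A function in `H²` vanishing at the distinct points `a₁, …, aₘ` is divisible by the Blaschke
product with these zeros. -/
theorem fourierCoeff_conj_prod_blaschkeFactor_mul {ι : Type*} {a : ι → 𝔻}
    (ha : Function.Injective a) {f : UnitTorus → ℂ}
    (hf : MemLp f 2 torusMeasure) (hf0 : ∀ n : ℤ, n < 0 → fourierCoeff f n = 0)
    (h : ∀ j, ∫ x, conj (szegoKernel (a j) x) * f x ∂torusMeasure = 0) (s : Finset ι) :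
    MemLp (fun x => conj (∏ j ∈ s, blaschkeFactor (a j) x) * f x) 2 torusMeasure ∧
    (∀ n : ℤ, n < 0 →
      fourierCoeff (fun x => conj (∏ j ∈ s, blaschkeFactor (a j) x) * f x) n = 0) ∧
    ∀ j ∉ s, ∫ x, conj (szegoKernel (a j) x) *
      (conj (∏ j ∈ s, blaschkeFactor (a j) x) * f x) ∂torusMeasure = 0 := by
  classical
  induction s using Finset.induction_on with
  | empty => simpa using ⟨hf, hf0, h⟩
  | insert i s hi ih =>
    obtain ⟨h1, h2, h3⟩ := ih
    have e : (fun x => conj (∏ j ∈ insert i s, blaschkeFactor (a j) x) * f x) =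
        fun x => conj (blaschkeFactor (a i) x) *
          (conj (∏ j ∈ s, blaschkeFactor (a j) x) * f x) := by
      ext x
      rw [Finset.prod_insert hi, map_mul, mul_assoc]
    set g := fun x => conj (∏ j ∈ s, blaschkeFactor (a j) x) * f x with hg
    have hm : MemLp (fun x => conj (blaschkeFactor (a i) x) * g x) 2 torusMeasure :=
      Continuous.mul_memLp_torus (isDiskAlgebra_blaschkeFactor (a i)).continuous.star h1
    have hn := fourierCoeff_conj_blaschkeFactor_mul h1 h2 (h3 i hi)
    refine ⟨by rwa [e], by rwa [e], fun j hj => ?_⟩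
    simp only [congrFun e]
    have hji : j ≠ i := fun hh => hj (by simp [hh])
    have h4 := h3 j fun hh => hj (by simp [hh])
    -- Dividing by the factor at a_i keeps the zero at a_j: multiplying back restores g, and the
    -- factor at a_i is nonzero at a_j since the points are distinct.
    have h5 := (EvalsTo.of_blaschkeFactor (a j) (a i)).integral_mul hm hn
    have h6 : (fun x => blaschkeFactor (a i) x * (conj (blaschkeFactor (a i) x) * g x)) = g := by
      ext x
      linear_combination g x * conj_blaschkeFactor_mul_self (a i) x
    simp only [congrFun h6] at h5
    rw [h4] at h5
    refine (mul_eq_zero.1 h5.symm).resolve_left (mul_ne_zero ?_ (inv_ne_zero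
      (one_sub_conj_mul_coe_ne_zero _ _)))
    exact sub_ne_zero.2 fun hh => hji (ha (Complex.UnitDisc.coe_injective hh))

/-- Vanishing at all the zeros of B puts f in B H², to which f is also orthogonal. -/
theorem eq_zero_of_inner_szegoLp {m : ℕ} (c : Circle) {a : Fin m → 𝔻} (ha : Function.Injective a)
    {f : L2Torus} (hf : f ∈ modelSpace (onTorus (blaschke c a)))
    (h : ∀ j, ⟪szegoLp (a j), f⟫_ℂ = 0) : f = 0 := by
  rw [mem_modelSpace_iff (isInner_blaschke c a)] at hf
  simp only [inner_szegoLp] at h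
  obtain ⟨h1, h2, -⟩ := fourierCoeff_conj_prod_blaschkeFactor_mul ha (Lp.memLp f) hf.1 h Finset.univ
  have h3 := hf.2 (h1.toLp _) fun n hn => by
    rw [fourierCoeff_congr_ae h1.coeFn_toLp]; exact h2 n hn
  -- The test function is f divided by the product without its constant c, so B times it is c f.
  have h4 : conj (c : ℂ) * ⟪f, f⟫_ℂ = 0 := by
    rw [← h3, L2.inner_def, ← integral_const_mul]
    refine integral_congr_ae ?_
    filter_upwards [h1.coeFn_toLp] with x hx
    rw [hx, onTorus_blaschke, RCLike.inner_apply]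
    have h5 : (∏ j, blaschkeFactor (a j) x) * conj (∏ j, blaschkeFactor (a j) x) = 1 := by
      rw [map_prod, ← Finset.prod_mul_distrib]
      exact Finset.prod_eq_one fun j _ => by rw [mul_comm, conj_blaschkeFactor_mul_self]
    simp only [map_mul, Complex.conj_conj]
    linear_combination (-(conj (c : ℂ) * conj (f x) * f x)) * h5
  exact inner_self_eq_zero.1 ((mul_eq_zero.1 h4).resolve_left (by simp))

/-- The part of f orthogonal to the span of the kernels stays in the model space and vanishes at
every a_j, hence is zero. -/
theorem exists_eq_sum_szegoLp {m : ℕ} (c : Circle) {a : Fin m → 𝔻} (ha : Function.Injective a)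
    {f : L2Torus} (hf : f ∈ modelSpace (onTorus (blaschke c a))) :
    ∃ t : Fin m → ℂ, ∑ j, t j • szegoLp (a j) = f := by
  let S := Submodule.span ℂ (Set.range fun j => szegoLp (a j))
  have hS : S ≤ modelSpace (onTorus (blaschke c a)) :=
    Submodule.span_le.2 (by rintro _ ⟨j, rfl⟩; exact szegoLp_mem_modelSpace c a j)
  have : FiniteDimensional ℂ S := FiniteDimensional.span_of_finite ℂ (Set.finite_range _)
  have h := eq_zero_of_inner_szegoLp c ha (f := f - S.starProjection f)
    (Submodule.sub_mem _ hf (hS (Submodule.starProjection_apply_mem _ _))) fun j =>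
      (Submodule.mem_orthogonal _ _).1 (Submodule.sub_starProjection_mem_orthogonal f) _
        (Submodule.subset_span ⟨j, rfl⟩)
  refine (Submodule.mem_span_range_iff_exists_fun ℂ).1 (?_ : f ∈ S)
  rw [sub_eq_zero.1 h]
  exact Submodule.starProjection_apply_mem _ _

/-! ### The conjugation and its action on kernels -/

theorem coeFn_modelConj {θ : UnitTorus → ℂ} (hθ : IsInner θ) (f : modelSpace θ) :
    (modelConj θ hθ f : L2Torus) =ᵐ[torusMeasure]
      fun x => θ x * conj ((toCircle x : ℂ) * (f : L2Torus) x) :=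
  (hθ.memLp_conj (f : L2Torus)).coeFn_toLp

/-- Both sides are the integral of conj θ · z · f · g. -/
theorem inner_modelConj_comm {θ : UnitTorus → ℂ} (hθ : IsInner θ) (f g : modelSpace θ) :
    ⟪(modelConj θ hθ f : L2Torus), (g : L2Torus)⟫_ℂ =
      ⟪(modelConj θ hθ g : L2Torus), (f : L2Torus)⟫_ℂ := by
  rw [L2.inner_def, L2.inner_def]
  refine integral_congr_ae ?_
  filter_upwards [coeFn_modelConj hθ f, coeFn_modelConj hθ g] with x h1 h2
  rw [h1, h2, RCLike.inner_apply, RCLike.inner_apply]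
  simp only [map_mul, Complex.conj_conj]
  ring

theorem modelConj_modelConj {θ : UnitTorus → ℂ} (hθ : IsInner θ) (f : modelSpace θ) :
    modelConj θ hθ (modelConj θ hθ f) = f := by
  refine Subtype.ext (Lp.ext ?_)
  filter_upwards [coeFn_modelConj hθ f, coeFn_modelConj hθ (modelConj θ hθ f), hθ.norm_eq_one]
    with x h1 h2 h3
  have h4 : conj (θ x) * θ x = 1 := by rw [Complex.conj_mul', h3]; simp
  rw [h2, h1]
  simp only [map_mul, Complex.conj_conj]
  linear_combination ((f : L2Torus) x * conj (toCircle x : ℂ) * toCircle x) * h4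
    + (f : L2Torus) x * conj_toCircle_mul_self x

/-- This form of C-symmetry is the symmetry of a bilinear form, so it can be tested on kernels and
involves no adjoint. -/
theorem isCSymmetric_iff {H : Type*} [NormedAddCommGroup H] [InnerProductSpace ℂ H]
    [CompleteSpace H] {C : H →ₗ⋆[ℂ] H} (hC : ∀ f g, ⟪C f, g⟫_ℂ = ⟪C g, f⟫_ℂ)
    (hC' : ∀ f, C (C f) = f) (A : H →L[ℂ] H) :
    IsCSymmetric C A ↔ ∀ f g, ⟪C f, A g⟫_ℂ = ⟪C g, A f⟫_ℂ := by
  refine ⟨fun h f g => ?_, fun h f => ext_inner_right ℂ fun g => ?_⟩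
  · have h1 := congrArg (fun y => ⟪y, f⟫_ℂ) (h (C g))
    simp only [hC', ContinuousLinearMap.adjoint_inner_left] at h1
    rw [← h1, hC]
  · rw [ContinuousLinearMap.adjoint_inner_left, hC, h, hC']

theorem isCSymmetric_modelConj_iff {θ : UnitTorus → ℂ} (hθ : IsInner θ)
    (T : modelSpace θ →L[ℂ] modelSpace θ) :
    IsCSymmetric (modelConj θ hθ) T ↔ ∀ f g,
      ⟪(modelConj θ hθ f : L2Torus), (T g : L2Torus)⟫_ℂ =
        ⟪(modelConj θ hθ g : L2Torus), (T f : L2Torus)⟫_ℂ :=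
  isCSymmetric_iff (inner_modelConj_comm hθ) (modelConj_modelConj hθ) T

/-- On the circle the factor b at a_j satisfies b · conj (z k_j) = k_j, so the conjugation strips
this factor from B and leaves a function vanishing at the other zeros. -/
theorem modelConj_szegoModel {m : ℕ} (c : Circle) (a : Fin m → 𝔻) (j : Fin m) :
    (modelConj _ (isInner_blaschke c a) (szegoModel c a j) : L2Torus) =ᵐ[torusMeasure]
      fun x => c * ((∏ r ∈ Finset.univ.erase j, blaschkeFactor (a r) x) * szegoKernel (a j) x) := by
  filter_upwards [coeFn_modelConj (isInner_blaschke c a) (szegoModel c a j), coeFn_szegoLp (a j)]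
    with x h1 h2
  have h3 : ((szegoModel c a j : L2Torus) : UnitTorus → ℂ) x = szegoKernel (a j) x := h2
  have h4 := congrArg conj (szegoKernel_mul (a j) x)
  simp only [map_sub, map_mul, map_one, Complex.conj_conj] at h4
  rw [h1, h3, onTorus_blaschke, ← Finset.mul_prod_erase _ _ (Finset.mem_univ j), blaschkeFactor_eq,
    map_mul]
  linear_combination (c * (∏ r ∈ Finset.univ.erase j, blaschkeFactor (a r) x) *
    szegoKernel (a j) x) * (h4 + conj (szegoKernel (a j) x) * conj_toCircle_mul_self x)

/-- The functions `C k_j` are, up to nonzero factors, biorthogonal to the kernels `k_j`. -/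
theorem exists_inner_szegoLp_modelConj {m : ℕ} (c : Circle) {a : Fin m → 𝔻}
    (ha : Function.Injective a) : ∃ β : Fin m → ℂ, (∀ j, β j ≠ 0) ∧ ∀ i j,
      ⟪szegoLp (a i), (modelConj _ (isInner_blaschke c a) (szegoModel c a j) : L2Torus)⟫_ℂ =
        if i = j then β j else 0 := by
  have key : ∀ i j,
      ⟪szegoLp (a i), (modelConj _ (isInner_blaschke c a) (szegoModel c a j) : L2Torus)⟫_ℂ =
      c * ((∏ r ∈ Finset.univ.erase j, ((a i : ℂ) - (a r : ℂ)) *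
        (1 - conj (a r : ℂ) * (a i : ℂ))⁻¹) * (1 - conj (a j : ℂ) * (a i : ℂ))⁻¹) := fun i j =>
    ((EvalsTo.const (a i) (c : ℂ)).mul ((EvalsTo.prod _ fun r _ =>
      EvalsTo.of_blaschkeFactor (a i) (a r)).mul
        (EvalsTo.of_szegoKernel (a i) (a j)))).inner_szegoLp (modelConj_szegoModel c a j)
  refine ⟨fun j =>
    ⟪szegoLp (a j), (modelConj _ (isInner_blaschke c a) (szegoModel c a j) : L2Torus)⟫_ℂ,
    fun j => ?_, fun i j => ?_⟩
  · simp only [key]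
    refine mul_ne_zero (by simp) (mul_ne_zero (Finset.prod_ne_zero_iff.2 fun r hr =>
      mul_ne_zero ?_ ?_) ?_)
    · exact sub_ne_zero.2 fun h =>
        Finset.ne_of_mem_erase hr (ha (Complex.UnitDisc.coe_injective h)).symm
    · exact inv_ne_zero (one_sub_conj_mul_coe_ne_zero _ _)
    · exact inv_ne_zero (one_sub_conj_mul_coe_ne_zero _ _)
  · split_ifs with h
    · rw [h]
    · rw [key, Finset.prod_eq_zero (Finset.mem_erase.2 ⟨h, Finset.mem_univ i⟩) (by simp)]
      simp

/-- The expansion of `C k_j` in the basis of kernels, tested against `g`. -/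
theorem exists_inner_modelConj_szegoModel {m : ℕ} (c : Circle) {a : Fin m → 𝔻}
    (ha : Function.Injective a) : ∃ β : Fin m → ℂ, (∀ j, β j ≠ 0) ∧
      (∀ i j, ⟪(modelConj _ (isInner_blaschke c a) (szegoModel c a j) : L2Torus), szegoLp (a i)⟫_ℂ =
        if i = j then conj (β j) else 0) ∧
      ∀ (j : Fin m) (g : L2Torus),
        ⟪(modelConj _ (isInner_blaschke c a) (szegoModel c a j) : L2Torus), g⟫_ℂ =
          ∑ l, ⟪szegoLp (a l), szegoLp (a j)⟫_ℂ / β l * ⟪szegoLp (a l), g⟫_ℂ := by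
  obtain ⟨β, hβ, h⟩ := exists_inner_szegoLp_modelConj c ha
  have h' : ∀ i j,
      ⟪(modelConj _ (isInner_blaschke c a) (szegoModel c a j) : L2Torus), szegoLp (a i)⟫_ℂ =
        if i = j then conj (β j) else 0 := fun i j => by
    rw [← inner_conj_symm, h]
    split_ifs <;> simp
  refine ⟨β, hβ, h', fun j g => ?_⟩
  obtain ⟨t, ht⟩ := exists_eq_sum_szegoLp c ha
    (modelConj _ (isInner_blaschke c a) (szegoModel c a j)).2
  -- The coefficients t of C k_j are found by pairing with C k_l: biorthogonality leaves t_l conj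
  -- β_l, while C being an involution turns the same pairing into ⟪k_j, k_l⟫.
  have h1 : ∀ l, ⟪szegoLp (a j), szegoLp (a l)⟫_ℂ = t l * conj (β l) := fun l => by
    have h2 := inner_modelConj_comm (isInner_blaschke c a) (szegoModel c a l)
      (modelConj _ (isInner_blaschke c a) (szegoModel c a j))
    rw [modelConj_modelConj, ← ht, inner_sum] at h2
    simp only [inner_smul_right, h'] at h2
    simpa [szegoModel] using h2.symm
  rw [← ht, sum_inner]
  refine Finset.sum_congr rfl fun l _ => ?_
  rw [inner_smul_left, ← inner_conj_symm (szegoLp (a l)) (szegoLp (a j)), h1]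
  simp [hβ l]

/-! ### The matrix argument -/

/-- If `κᵀ D κ` is an invertible diagonal matrix, with `D = diag(β)⁻¹`, then `κᵀ` is injective. -/
theorem eq_zero_of_sum_mul_eq_zero {n : ℕ} {κ : Fin n → Fin n → ℂ} {β γ : Fin n → ℂ}
    (hγ : ∀ j, γ j ≠ 0)
    (h : ∀ i j, ∑ l, κ l j / β l * κ l i = if i = j then γ j else 0) {x : Fin n → ℂ}
    (hx : ∀ i, ∑ l, κ l i * x l = 0) : x = 0 := by
  let P : Matrix (Fin n) (Fin n) ℂ := Matrix.of fun i l => κ l i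
  let Q : Matrix (Fin n) (Fin n) ℂ := Matrix.of fun l j => κ l j / β l / γ j
  have hPQ : P * Q = 1 := by
    ext i j
    have h1 : (P * Q) i j = (∑ l, κ l j / β l * κ l i) / γ j := by
      rw [Matrix.mul_apply, Finset.sum_div]
      exact Finset.sum_congr rfl fun l _ => by simp only [P, Q, Matrix.of_apply]; ring
    rw [h1, h, Matrix.one_apply]
    split_ifs
    · exact div_self (hγ j)
    · exact zero_div _
  have hP : P.mulVec x = 0 := funext fun i => hx i
  -- The matrices are square, so the right inverse Q of P is also a left inverse.
  rw [← Matrix.one_mulVec x, ← mul_eq_one_comm.1 hPQ, ← Matrix.mulVec_mulVec, hP,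
    Matrix.mulVec_zero]

/-- A matrix `m` satisfying the weighted symmetry relation on all leading principal blocks is of
the form `m i j = u i + v j`. -/
theorem exists_eq_add_of_weighted_symm {n : ℕ} (κ m : Fin n → Fin n → ℂ) (hκ : ∀ i j, κ i j ≠ 0)
    (H : ∀ (k : ℕ) (_ : 1 ≤ k) (hk : k ≤ n), ∃ β γ : Fin k → ℂ, (∀ l, β l ≠ 0) ∧ (∀ l, γ l ≠ 0) ∧
      (∀ i j, ∑ l, κ (Fin.castLE hk l) (Fin.castLE hk j) / β l *
        κ (Fin.castLE hk l) (Fin.castLE hk i) = if i = j then γ j else 0) ∧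
      ∀ i j, ∑ l, κ (Fin.castLE hk l) (Fin.castLE hk j) / β l *
          (κ (Fin.castLE hk l) (Fin.castLE hk i) * m (Fin.castLE hk l) (Fin.castLE hk i)) =
        ∑ l, κ (Fin.castLE hk l) (Fin.castLE hk i) / β l *
          (κ (Fin.castLE hk l) (Fin.castLE hk j) * m (Fin.castLE hk l) (Fin.castLE hk j))) :
    ∃ u v : Fin n → ℂ, ∀ i j, m i j = u i + v j := by
  induction n with
  | zero => exact ⟨0, 0, fun i => i.elim0⟩
  | succ n ih =>
    obtain ⟨u, v, huv⟩ := ih (fun i j => κ i.castSucc j.castSucc)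
      (fun i j => m i.castSucc j.castSucc) (fun i j => hκ _ _)
      fun k h1 hk => H k h1 (hk.trans n.le_succ)
    rcases Nat.eq_zero_or_pos n with rfl | hn
    · exact ⟨fun _ => m 0 0, 0, fun i j => by
        rw [Fin.fin_one_eq_zero i, Fin.fin_one_eq_zero j]; simp⟩
    obtain ⟨β₀, γ₀, -, hγ₀, hsum₀, -⟩ := H n hn n.le_succ
    obtain ⟨β, γ, hβ, -, hsum, hsymm⟩ := H (n + 1) (by omega) le_rfl
    simp only [Fin.castLE_rfl, id_eq] at hsum hsymm
    let o : Fin n := ⟨0, hn⟩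
    -- The two new parameters are chosen so that the defect d vanishes at (last, o) and (last,
    -- last); the inductive hypothesis already kills the old block.
    let u₁ : ℂ := m (Fin.last n) o.castSucc - v o
    let U : Fin (n + 1) → ℂ := Fin.snoc u u₁
    let V : Fin (n + 1) → ℂ := Fin.snoc v (m (Fin.last n) (Fin.last n) - u₁)
    let d : Fin (n + 1) → Fin (n + 1) → ℂ := fun i j => m i j - (U i + V j)
    have hd : ∀ i j : Fin n, d i.castSucc j.castSucc = 0 := fun i j => by
      simp [d, U, V, huv]
    have hd0 : d (Fin.last n) o.castSucc = 0 := by simp [d, U, V, u₁]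
    have hdl : d (Fin.last n) (Fin.last n) = 0 := by simp [d, U, V]
    -- The defect obeys the same symmetry: the U terms cancel, and the V terms contribute V i - V j
    -- times an off-diagonal entry of `hsum`, which is zero.
    have E : ∀ i j, i ≠ j → ∑ l, κ l j * κ l i / β l * (d l i - d l j) = 0 := fun i j hij => by
      have h1 := sub_eq_zero.2 (hsymm i j)
      rw [← Finset.sum_sub_distrib] at h1
      have h2 := congrArg ((V i - V j) * ·) (hsum i j)
      simp only [if_neg hij, mul_zero, Finset.mul_sum] at h2
      have h3 := congrArg₂ (· - ·) h1 h2
      simp only [← Finset.sum_sub_distrib, sub_zero] at h3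
      rw [← h3]
      exact Finset.sum_congr rfl fun l _ => by simp only [d]; ring
    have hdrow : ∀ i : Fin n, d (Fin.last n) i.castSucc = 0 := fun i => by
      by_cases hi : i = o
      · rw [hi, hd0]
      -- With both indices in the old block only the term l = last survives, and its weight is
      -- nonzero.
      have h1 := E i.castSucc o.castSucc fun h => hi (Fin.castSucc_injective _ h)
      rw [Fin.sum_univ_castSucc] at h1
      simpa [hd, hd0, hκ, hβ] using h1
    have hdcol : ∀ l : Fin n, d l.castSucc (Fin.last n) = 0 := fun l => by
      -- With the last row gone, the relations for (last, i) form a homogeneous system for the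
      -- weighted last column; its matrix is the transposed old block of κ, which is injective by
      -- the size-n relation.
      have h1 := eq_zero_of_sum_mul_eq_zero hγ₀ hsum₀
        (x := fun l => κ l.castSucc (Fin.last n) / β l.castSucc * d l.castSucc (Fin.last n))
        fun i => by
          have h2 := E (Fin.last n) i.castSucc (Fin.castSucc_lt_last i).ne'
          rw [Fin.sum_univ_castSucc] at h2
          simp only [hd, hdl, hdrow, sub_zero, mul_zero, add_zero] at h2
          rw [← h2]
          exact Finset.sum_congr rfl fun l _ => by
            simp only [show Fin.castLE n.le_succ = Fin.castSucc from rfl]; ring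
      simpa [hκ, hβ] using congrFun h1 l
    refine ⟨U, V, fun i j => sub_eq_zero.1 ?_⟩
    change d i j = 0
    induction i using Fin.lastCases with
    | last => induction j using Fin.lastCases with
      | last => exact hdl
      | cast j => exact hdrow j
    | cast i => induction j using Fin.lastCases with
      | last => exact hdcol i
      | cast j => exact hd i j

/-! ### Truncated Toeplitz operators on `K²_B` -/

theorem exists_continuous_ae_eq {m : ℕ} (c : Circle) {a : Fin m → 𝔻} (ha : Function.Injective a)
    {f : L2Torus} (hf : f ∈ modelSpace (onTorus (blaschke c a))) :
    ∃ F : UnitTorus → ℂ, Continuous F ∧ f =ᵐ[torusMeasure] F := by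
  obtain ⟨t, rfl⟩ := exists_eq_sum_szegoLp c ha hf
  refine Finset.sum_induction _ (fun f : L2Torus => ∃ F : UnitTorus → ℂ, Continuous F ∧
    f =ᵐ[torusMeasure] F) ?_ ⟨0, continuous_zero, Lp.coeFn_zero _ _ _⟩ fun j _ => ?_
  · rintro f g ⟨F, hF, hf⟩ ⟨G, hG, hg⟩
    exact ⟨F + G, hF.add hG, (Lp.coeFn_add f g).trans (hf.add hg)⟩
  · exact ⟨t j • szegoKernel (a j), (isDiskAlgebra_szegoKernel (a j)).continuous.const_smul (t j),
      (Lp.coeFn_smul _ _).trans ((coeFn_szegoLp (a j)).const_smul (t j))⟩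

/-- Elements of the model space are finite sums of continuous kernels, so every L² symbol acts on
the whole space. -/
theorem mem_truncatedToeplitzDomain {m : ℕ} (c : Circle) {a : Fin m → 𝔻}
    (ha : Function.Injective a) (φ : L2Torus) (f : modelSpace (onTorus (blaschke c a))) :
    f ∈ truncatedToeplitzDomain (onTorus (blaschke c a)) φ := by
  obtain ⟨F, hF, hf⟩ := exists_continuous_ae_eq c ha f.2
  refine MemLp.ae_eq ?_ (hF.mul_memLp_torus (Lp.memLp φ))
  filter_upwards [hf] with x hx
  rw [hx, mul_comm]

theorem inner_compression {α θ : UnitTorus → ℂ} (hα : IsInner α) (h : InnerDivides α θ)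
    (A : modelSpace θ →L[ℂ] modelSpace θ) (f g : modelSpace α) :
    ⟪(f : L2Torus), (compression α θ hα h A g : L2Torus)⟫_ℂ =
      ⟪(f : L2Torus), (A ⟨g, modelSpace_le_of_innerDivides hα h g.2⟩ : L2Torus)⟫_ℂ :=
  (modelSpace α).inner_orthogonalProjectionOnto_eq_of_mem_left f _

/-- Compressions of truncated Toeplitz operators are complex symmetric. -/
theorem IsTruncatedToeplitz.isCSymmetric_compression {α θ : UnitTorus → ℂ} (hα : IsInner α)
    (h : InnerDivides α θ) {A : modelSpace θ →L[ℂ] modelSpace θ} {φ : L2Torus}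
    (hφ : ∀ f, f ∈ truncatedToeplitzDomain θ φ)
    (hA : ∀ f, A f = (modelSpace θ).orthogonalProjectionOnto (MemLp.toLp _ (hφ f))) :
    IsCSymmetric (modelConj α hα) (compression α θ hα h A) := by
  have key : ∀ f g : modelSpace α,
      ⟪(modelConj α hα f : L2Torus), (compression α θ hα h A g : L2Torus)⟫_ℂ =
        ∫ x, conj (α x) * toCircle x * φ x * ((f : L2Torus) x * (g : L2Torus) x)
          ∂torusMeasure := fun f g => by
    rw [inner_compression, hA]
    -- The projection onto K²_θ drops out because C f lies in K²_α, hence in K²_θ.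
    refine ((modelSpace θ).inner_orthogonalProjectionOnto_eq_of_mem_left
      ⟨modelConj α hα f, modelSpace_le_of_innerDivides hα h (modelConj α hα f).2⟩ _).trans ?_
    rw [L2.inner_def]
    refine integral_congr_ae ?_
    filter_upwards [coeFn_modelConj hα f,
      (hφ ⟨g, modelSpace_le_of_innerDivides hα h g.2⟩).coeFn_toLp] with x h1 h2
    rw [h1, h2, RCLike.inner_apply]
    simp only [map_mul, Complex.conj_conj]
    ring
  refine (isCSymmetric_modelConj_iff hα _).2 fun f g => ?_
  rw [key, key]
  simp only [mul_comm]

/-- The analytic part p k_b is evaluated at a by k_a; the co-analytic part, once conjugated, is q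
k_a evaluated at b by k_b. -/
theorem integral_conj_szegoKernel_mul_symbol (a b : 𝔻) (p q : Polynomial ℂ) :
    ∫ x, conj (szegoKernel a x) * ((p.eval (toCircle x : ℂ) + conj (q.eval (toCircle x : ℂ))) *
      szegoKernel b x) ∂torusMeasure =
      ⟪szegoLp a, szegoLp b⟫_ℂ * (p.eval (a : ℂ) + conj (q.eval (b : ℂ))) := by
  have hka := (isDiskAlgebra_szegoKernel a).continuous
  have hkb := (isDiskAlgebra_szegoKernel b).continuous
  have hp := (EvalsTo.polynomial a p).isDiskAlgebra.continuous
  have hq := (EvalsTo.polynomial a q).isDiskAlgebra.continuous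
  have h1 := ((EvalsTo.polynomial a p).mul (EvalsTo.of_szegoKernel a b)).integral_eq
  have h2 := congrArg conj ((EvalsTo.polynomial b q).mul (EvalsTo.of_szegoKernel b a)).integral_eq
  rw [← integral_conj] at h2
  rw [inner_szegoLp_szegoLp]
  have h3 : (1 - conj (b : ℂ) * (a : ℂ))⁻¹ = conj (1 - conj (a : ℂ) * (b : ℂ))⁻¹ := by
    rw [map_inv₀]
    simp [mul_comm]
  have h4 : (1 - conj (b : ℂ) * (a : ℂ))⁻¹ * (p.eval (a : ℂ) + conj (q.eval (b : ℂ))) =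
      p.eval (a : ℂ) * (1 - conj (b : ℂ) * (a : ℂ))⁻¹ +
        conj (q.eval (b : ℂ) * (1 - conj (a : ℂ) * (b : ℂ))⁻¹) := by
    rw [map_mul, ← h3]
    ring
  rw [h4, ← h1, ← h2, ← integral_add]
  · refine integral_congr_ae (Filter.Eventually.of_forall fun x => ?_)
    simp only [map_mul, Complex.conj_conj]
    ring
  · exact Continuous.integrable_torus (hka.star.mul (hp.mul hkb))
  · exact Continuous.integrable_torus (hkb.star.mul (hq.mul hka)).star

/-- An operator on `K²_B` whose matrix in the basis of kernels is `⟪k_i, k_j⟫ (u_i + v_j)` is a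
truncated Toeplitz operator. -/
theorem isTruncatedToeplitz_of_inner_eq {m : ℕ} (c : Circle) {a : Fin m → 𝔻}
    (ha : Function.Injective a)
    (A : modelSpace (onTorus (blaschke c a)) →L[ℂ] modelSpace (onTorus (blaschke c a)))
    (u v : Fin m → ℂ)
    (h : ∀ i j, ⟪szegoLp (a i), (A (szegoModel c a j) : L2Torus)⟫_ℂ =
      ⟪szegoLp (a i), szegoLp (a j)⟫_ℂ * (u i + v j)) :
    IsTruncatedToeplitz (onTorus (blaschke c a)) A := by
  have hinj : Set.InjOn (fun j => (a j : ℂ)) (Finset.univ : Finset (Fin m)) :=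
    (Complex.UnitDisc.coe_injective.comp ha).injOn
  let p := Lagrange.interpolate Finset.univ (fun j => (a j : ℂ)) u
  -- The values are conjugated because q enters the symbol as conj q.
  let q := Lagrange.interpolate Finset.univ (fun j => (a j : ℂ)) fun j => conj (v j)
  have hp : ∀ j, p.eval (a j : ℂ) = u j := fun j =>
    Lagrange.eval_interpolate_at_node u hinj (Finset.mem_univ j)
  have hq : ∀ j, q.eval (a j : ℂ) = conj (v j) := fun j =>
    Lagrange.eval_interpolate_at_node _ hinj (Finset.mem_univ j)
  let s : UnitTorus → ℂ := fun x => p.eval (toCircle x : ℂ) + conj (q.eval (toCircle x : ℂ))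
  have hs : Continuous s := by
    have hz := continuous_toCircle_coe
    exact (p.continuous.comp hz).add (Complex.continuous_conj.comp (q.continuous.comp hz))
  have hdom := mem_truncatedToeplitzDomain c ha (hs.memLp_torus.toLp s)
  refine ⟨hs.memLp_torus.toLp s, ?_, fun f hf => ?_⟩
  · rw [Set.eq_univ_of_forall hdom]
    exact dense_univ
  refine Subtype.ext (sub_eq_zero.1 (eq_zero_of_inner_szegoLp c ha
    (Submodule.sub_mem _ (A f).2 (Subtype.prop _)) fun i => ?_))
  -- Moving the symbol to the left slot makes the pairing linear in f, so comparison on the kernels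
  -- suffices.
  let w : L2Torus := (hs.star.mul (isDiskAlgebra_szegoKernel (a i)).continuous).memLp_torus.toLp _
  have hw : w =ᵐ[torusMeasure] fun x => conj (s x) * szegoKernel (a i) x := MemLp.coeFn_toLp _
  have hwf : ⟪szegoLp (a i), ((modelSpace (onTorus (blaschke c a))).orthogonalProjectionOnto
      (MemLp.toLp _ hf) : L2Torus)⟫_ℂ = ⟪w, (f : L2Torus)⟫_ℂ := by
    refine ((modelSpace _).inner_orthogonalProjectionOnto_eq_of_mem_left
      (szegoModel c a i) _).trans ?_
    rw [L2.inner_def, L2.inner_def]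
    refine integral_congr_ae ?_
    filter_upwards [hw, hf.coeFn_toLp, hs.memLp_torus.coeFn_toLp, coeFn_szegoLp (a i)]
      with x h1 h2 h3 h4
    have h5 : ((szegoModel c a i : L2Torus) : UnitTorus → ℂ) x = szegoKernel (a i) x := h4
    rw [h1, h2, h3, h5, RCLike.inner_apply, RCLike.inner_apply]
    simp only [map_mul, Complex.conj_conj]
    ring
  have hwk : ∀ j, ⟪w, szegoLp (a j)⟫_ℂ = ⟪szegoLp (a i), (A (szegoModel c a j) : L2Torus)⟫_ℂ := by
    intro j
    rw [h, ← hp i, ← Complex.conj_conj (v j), ← hq j, ← integral_conj_szegoKernel_mul_symbol, L2.inner_def]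
    refine integral_congr_ae ?_
    filter_upwards [hw, coeFn_szegoLp (a j)] with x h1 h2
    rw [h1, h2, RCLike.inner_apply]
    simp only [map_mul, Complex.conj_conj, s]
    ring
  obtain ⟨t, ht⟩ := exists_eq_sum_szegoLp c ha f.2
  have ht' : f = ∑ j, t j • szegoModel c a j := by
    refine Subtype.ext ?_
    rw [← ht]
    simp [szegoModel]
  have hAf : (A f : L2Torus) = ∑ j, t j • (A (szegoModel c a j) : L2Torus) := by
    rw [ht']
    simp
  rw [inner_sub_right, hwf, hAf, ← ht, inner_sum, inner_sum, sub_eq_zero]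
  exact Finset.sum_congr rfl fun j _ => by rw [inner_smul_right, inner_smul_right, hwk]

/-- The kernels at the first n zeros lie in K²_{B_n}, so C-symmetry of the n-th compression tested
on them constrains exactly the leading n × n block of the matrix of A. -/
theorem exists_inner_eq_of_isCSymmetric {N : ℕ} (c : Circle) {a : Fin N → 𝔻}
    (ha : Function.Injective a)
    (A : modelSpace (onTorus (blaschke c a)) →L[ℂ] modelSpace (onTorus (blaschke c a)))
    (h : ∀ (n : ℕ) (_ : 1 ≤ n) (hn : n ≤ N),
        IsCSymmetric
          (modelConj (onTorus (blaschke 1 (initialZeros a hn)))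
            (isInner_blaschke 1 (initialZeros a hn)))
          (compression (onTorus (blaschke 1 (initialZeros a hn))) (onTorus (blaschke c a))
            (isInner_blaschke 1 (initialZeros a hn))
            (innerDivides_blaschke_initialZeros c a hn) A)) :
    ∃ u v : Fin N → ℂ, ∀ i j, ⟪szegoLp (a i), (A (szegoModel c a j) : L2Torus)⟫_ℂ =
      ⟪szegoLp (a i), szegoLp (a j)⟫_ℂ * (u i + v j) := by
  have hκ : ∀ i j, ⟪szegoLp (a i), szegoLp (a j)⟫_ℂ ≠ 0 := fun i j => by
    rw [inner_szegoLp_szegoLp]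
    exact inv_ne_zero (one_sub_conj_mul_coe_ne_zero _ _)
  have hm : ∀ i j, ⟪szegoLp (a i), (A (szegoModel c a j) : L2Torus)⟫_ℂ =
      ⟪szegoLp (a i), szegoLp (a j)⟫_ℂ * (⟪szegoLp (a i), (A (szegoModel c a j) : L2Torus)⟫_ℂ /
        ⟪szegoLp (a i), szegoLp (a j)⟫_ℂ) := fun i j => (mul_div_cancel₀ _ (hκ i j)).symm
  obtain ⟨u, v, huv⟩ := exists_eq_add_of_weighted_symm
    (fun i j => ⟪szegoLp (a i), szegoLp (a j)⟫_ℂ)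
    (fun i j => ⟪szegoLp (a i), (A (szegoModel c a j) : L2Torus)⟫_ℂ /
      ⟪szegoLp (a i), szegoLp (a j)⟫_ℂ) hκ fun n h1 hn => by
    have hinj : Function.Injective (initialZeros a hn) := ha.comp (Fin.castLE_injective hn)
    obtain ⟨β, hβ, h2, h3⟩ := exists_inner_modelConj_szegoModel 1 hinj
    -- The diagonal γ is conj β: the weighted sum with m = 1 is ⟪C k_j, k_i⟫, given by
    -- biorthogonality.
    refine ⟨β, fun l => conj (β l), hβ, fun l => by simpa using hβ l, fun i j => ?_, fun i j => ?_⟩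
    · exact (h3 j _).symm.trans (h2 i j)
    · simp only [← hm]
      have h4 := (isCSymmetric_modelConj_iff _ _).1 (h n h1 hn)
        (szegoModel 1 (initialZeros a hn) j) (szegoModel 1 (initialZeros a hn) i)
      rw [inner_compression, inner_compression, h3, h3] at h4
      exact h4
  exact ⟨u, v, fun i j => by rw [← huv, ← hm]⟩

theorem theorem4p3 {N : ℕ} (a : Fin N → Complex.UnitDisc) (ha : Function.Injective a) (c : Circle)
    (A : modelSpace (onTorus (blaschke c a)) →L[ℂ] modelSpace (onTorus (blaschke c a))) :
    List.TFAE [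
      IsTruncatedToeplitz (onTorus (blaschke c a)) A,
      ∀ (m : ℕ) (_ : 1 ≤ m) (d : Circle) (b : Fin m → Complex.UnitDisc)
        (h : InnerDivides (onTorus (blaschke d b)) (onTorus (blaschke c a))),
        IsCSymmetric (modelConj (onTorus (blaschke d b)) (isInner_blaschke d b))
          (compression (onTorus (blaschke d b)) (onTorus (blaschke c a)) (isInner_blaschke d b) h A),
      ∀ (n : ℕ) (_ : 1 ≤ n) (hn : n ≤ N),
        IsCSymmetric
          (modelConj (onTorus (blaschke 1 (initialZeros a hn)))
            (isInner_blaschke 1 (initialZeros a hn)))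
          (compression (onTorus (blaschke 1 (initialZeros a hn))) (onTorus (blaschke c a))
            (isInner_blaschke 1 (initialZeros a hn))
            (innerDivides_blaschke_initialZeros c a hn) A)] := by
  tfae_have 1 → 2 := by
    rintro ⟨φ, -, hA⟩ m - d b h
    exact IsTruncatedToeplitz.isCSymmetric_compression _ h
      (mem_truncatedToeplitzDomain c ha φ) fun f => hA f _
  tfae_have 2 → 3 := fun H n h1 hn => H n h1 1 (initialZeros a hn) _
  tfae_have 3 → 1 := fun H => by
    obtain ⟨u, v, h⟩ := exists_inner_eq_of_isCSymmetric c ha A H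
    exact isTruncatedToeplitz_of_inner_eq c ha A u v h
  tfae_finish
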